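/- Let $d\ge 1$ and let $\mathbb F_d^+$ be the free monoid on the generators $1,\dots,d$, with concatenation as product and the empty word $\emptyset$ as identity. Let $\mathbb H^2_d$ be the Hilbert space of formal power series $\sum_{\sigma\in\mathbb F_d^+} c_\sigma Z^\sigma$ in noncommuting variables $Z_1,\dots,Z_d$ with $\sum_\sigma|c_\sigma|^2<\infty$, and let $L=(L_1,\dots,L_d)$, $L_jf=Z_jf$, be the left free shift on it; for $\sigma=\sigma_1\cdots\sigma_n$ put $L^\sigma=L_{\sigma_1}\cdots L_{\sigma_n}$, with $L^\emptyset=I$. Let $\mathcal A_d$ be the operator-norm closure of $\{p(L):p\in\mathbb C\langle Z_1,\dots,Z_d\rangle\}$, let $\mathcal A_d^*$ be the set of adjoints of elements of $\mathcal A_d$, and let $\mathscr A_d=\overline{\mathcal A_d+\mathcal A_d^*}$ (operator-norm closure) be the nc disc system. An nc measure is a linear map $\mu:\mathscr A_d\to\mathbb C$ with $\mu(f)\ge 0$ for every positive operator $f\in\mathscr A_d$. A kernel $K:\mathbb F_d^+\times\mathbb F_d^+\to\mathbb C$ is multi-Toeplitz if (a) the matrix $[K(\sigma,\tau)]_{\sigma,\tau\preceq\sigma_0}$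 is positive semi-definite for every $\sigma_0\in\mathbb F_d^+$, where $\preceq$ is the shortlex order; (b) $K(\tau\sigma,\tau\sigma')=K(\sigma,\sigma')$ for all $\tau,\sigma,\sigma'\in\mathbb F_d^+$; (c) $K(\sigma,\tau)=0$ whenever there is no $\alpha\in\mathbb F_d^+$ with $\sigma=\tau\alpha$ or $\tau=\sigma\alpha$. **Theorem.** 1. Let $K$ be a multi-Toeplitz kernel. Then $K(\emptyset,\sigma)=\overline{K(\sigma,\emptyset)}$ for all $\sigma$, and the assignment $$\mu_K(L^\sigma)=K(\sigma,\emptyset),\qquad \mu_K\big((L^\sigma)^*\big)=K(\emptyset,\sigma)\qquad(\sigma\in\mathbb F_d^+)$$ extends to a unique continuous linear functional $\mu_K$ on $\mathscr A_d$. This $\mu_K$ is an nc measure, it is the only nc measure with these values, and $\mu_K\big((L^\tau)^*L^\sigma\big)=K(\sigma,\tau)$ for all $\sigma,\tau\in\mathbb F_d^+$. 2. Let $\mu$ be an nc measure. Then the kernel $$K_\mu(\sigma,\tau)=\mu\big((L^\tau)^*L^\sigma\big)\qquad(\sigma,\tau\in\mathbb F_d^+)$$ is multi-Toeplitz. 3.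 The map $\mu\mapsto K_\mu$ is a bijection from the set of nc measures onto the set of multi-Toeplitz kernels on $\mathbb F_d^+$. -/

import Mathlib

open scoped ComplexOrder

/-! ### Words, the nc Hardy space and the left free shift -/

/-- The free monoid `𝔽_d⁺` on `d` generators: words, with concatenation as product and the empty
word `∅` as the identity `1`. -/
abbrev Word (d : ℕ) : Type := FreeMonoid (Fin d)

/-- The (non-strict) shortlex order `σ ⪯ τ` on words: first by length, then lexicographically. -/
def Word.ShortlexLE {d : ℕ} (σ τ : Word d) : Prop :=
  List.Shortlex (fun i j : Fin d => i < j) (FreeMonoid.toList σ) (FreeMonoid.toList τ) ∨ σ = τ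

/-- The nc Hardy space `ℍ²_d` (the full Fock space on `ℂ^d`): a power series `∑ c_σ Z^σ` with
square-summable coefficients is represented by its coefficient family `σ ↦ c_σ`. -/
abbrev NCHardy (d : ℕ) : Type := lp (fun _ : Word d => ℂ) 2

/-- Bounded operators on the nc Hardy space, with the operator norm and the adjoint as `star`. -/
abbrev NCHardyOp (d : ℕ) : Type := NCHardy d →L[ℂ] NCHardy d

theorem Word.of_mul_injective {d : ℕ} (j : Fin d) :
    Function.Injective (fun τ : Word d => FreeMonoid.of j * τ) :=
  fun _ _ h => mul_left_cancel h

/-- The coefficients of `Z_j f(Z)`, where `c` is the coefficient family of `f`: the coefficient of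
`Z_j Z^τ` is `c τ`, and the coefficient of any word that does not begin with `j` is `0`. -/
noncomputable def shiftCoeff {d : ℕ} (j : Fin d) (c : Word d → ℂ) : Word d → ℂ :=
  Function.extend (fun τ : Word d => FreeMonoid.of j * τ) c 0

theorem shiftCoeff_norm_rpow {d : ℕ} (j : Fin d) (c : Word d → ℂ) :
    (fun σ => ‖shiftCoeff j c σ‖ ^ (2 : ENNReal).toReal) =
      Function.extend (fun τ : Word d => FreeMonoid.of j * τ)
        (fun τ => ‖c τ‖ ^ (2 : ENNReal).toReal) 0 := by
  funext σ
  by_cases h : ∃ τ : Word d, FreeMonoid.of j * τ = σ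
  · obtain ⟨τ, rfl⟩ := h
    rw [shiftCoeff, (Word.of_mul_injective j).extend_apply, (Word.of_mul_injective j).extend_apply]
  · rw [shiftCoeff, Function.extend_apply' _ _ _ h, Function.extend_apply' _ _ _ h]
    simp

theorem shiftCoeff_hasSum {d : ℕ} (j : Fin d) (f : NCHardy d) :
    HasSum (fun σ => ‖shiftCoeff j f σ‖ ^ (2 : ENNReal).toReal) (‖f‖ ^ (2 : ENNReal).toReal) := by
  rw [shiftCoeff_norm_rpow, hasSum_extend_zero (Word.of_mul_injective j)]
  exact lp.hasSum_norm (by norm_num) f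

/-- The `j`-th left free shift `(L_j f)(Z) = Z_j f(Z)` as a linear isometry of `ℍ²_d`. -/
noncomputable def leftShiftIsometry {d : ℕ} (j : Fin d) : NCHardy d →ₗᵢ[ℂ] NCHardy d where
  toFun f := ⟨shiftCoeff j f, (memℓp_gen_iff (by norm_num)).2 (shiftCoeff_hasSum j f).summable⟩
  map_add' f g := by
    ext σ
    change shiftCoeff j (f + g : NCHardy d) σ = shiftCoeff j f σ + shiftCoeff j g σ
    by_cases h : ∃ τ : Word d, FreeMonoid.of j * τ = σ
    · obtain ⟨τ, rfl⟩ := h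
      simp only [shiftCoeff, (Word.of_mul_injective j).extend_apply]
      rfl
    · simp only [shiftCoeff, Function.extend_apply' _ _ _ h, Pi.zero_apply, add_zero]
  map_smul' a f := by
    ext σ
    change shiftCoeff j (a • f : NCHardy d) σ = a * shiftCoeff j f σ
    by_cases h : ∃ τ : Word d, FreeMonoid.of j * τ = σ
    · obtain ⟨τ, rfl⟩ := h
      simp only [shiftCoeff, (Word.of_mul_injective j).extend_apply]
      rfl
    · simp [shiftCoeff, Function.extend_apply' _ _ _ h]
  norm_map' f := by
    have h2 : 0 < (2 : ENNReal).toReal := by norm_num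
    refine (Real.rpow_left_inj (norm_nonneg _) (norm_nonneg _) h2.ne').1 ?_
    exact (lp.hasSum_norm h2 _).unique (shiftCoeff_hasSum j f)

/-- The left free shift `L = (L_1, …, L_d)` as a tuple of bounded operators on `ℍ²_d`. -/
noncomputable def leftShift {d : ℕ} (j : Fin d) : NCHardyOp d :=
  (leftShiftIsometry j).toContinuousLinearMap

/-- `L^σ = L_{σ₁} ⋯ L_{σₙ}` for a word `σ = σ₁ ⋯ σₙ`, with `L^∅ = I`. -/
noncomputable def leftShiftPow {d : ℕ} (σ : Word d) : NCHardyOp d :=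
  FreeMonoid.lift leftShift σ

/-! ### The nc disc algebra, the nc disc system and nc measures -/

/-- The nc disc algebra `𝒜_d`: the operator-norm closure of `{p(L) : p ∈ ℂ⟨Z_1, …, Z_d⟩}`. -/
noncomputable def ncDiscAlgebra (d : ℕ) : Subalgebra ℂ (NCHardyOp d) :=
  (FreeAlgebra.lift ℂ (leftShift (d := d))).range.topologicalClosure

/-- The nc disc system: the operator-norm closure of `𝒜_d + 𝒜_d^*`, where
`𝒜_d^* = star 𝒜_d` consists of the adjoints of the elements of `𝒜_d`. -/
noncomputable def ncDiscSystem (d : ℕ) : Submodule ℂ (NCHardyOp d) :=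
  (Subalgebra.toSubmodule (ncDiscAlgebra d) ⊔
    Subalgebra.toSubmodule (star (ncDiscAlgebra d))).topologicalClosure

/-- A linear functional on the nc disc system is an nc measure if it is positive: it takes
nonnegative (real) values at all positive operators in the nc disc system. -/
def IsNCMeasure {d : ℕ} (μ : ncDiscSystem d →ₗ[ℂ] ℂ) : Prop :=
  ∀ f : ncDiscSystem d, (f : NCHardyOp d).IsPositive → 0 ≤ μ f

/-! ### Membership of `L^σ`, `(L^σ)^*` and `(L^τ)^* L^σ` in the nc disc system -/

theorem leftShiftPow_mem_ncDiscAlgebra {d : ℕ} (σ : Word d) :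
    leftShiftPow σ ∈ ncDiscAlgebra d := by
  refine Subalgebra.le_topologicalClosure _ ?_
  induction σ using FreeMonoid.inductionOn' with
  | one =>
    rw [leftShiftPow, map_one]
    exact one_mem _
  | of_mul j σ ih =>
    rw [leftShiftPow, map_mul, FreeMonoid.lift_eval_of]
    exact mul_mem ⟨FreeAlgebra.ι ℂ j, by simp⟩ ih

theorem leftShiftPow_mem {d : ℕ} (σ : Word d) : leftShiftPow σ ∈ ncDiscSystem d :=
  Submodule.le_topologicalClosure _ (Submodule.mem_sup_left (leftShiftPow_mem_ncDiscAlgebra σ))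

theorem leftShiftPow_adjoint_mem {d : ℕ} (σ : Word d) :
    ContinuousLinearMap.adjoint (leftShiftPow σ) ∈ ncDiscSystem d := by
  refine Submodule.le_topologicalClosure _ (Submodule.mem_sup_right ?_)
  change star (leftShiftPow σ) ∈ star (ncDiscAlgebra d)
  exact (Subalgebra.star_mem_star_iff _ _).2 (leftShiftPow_mem_ncDiscAlgebra σ)

/-- The row-isometry relations `L_j^* L_k = δ_{jk} I`. -/
theorem leftShift_adjoint_mul {d : ℕ} (j k : Fin d) :
    star (leftShift j) * leftShift k = if j = k then (1 : NCHardyOp d) else 0 := by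
  refine ContinuousLinearMap.ext fun f => ext_inner_left ℂ fun g => ?_
  rw [ContinuousLinearMap.star_eq_adjoint, mul_apply_eq_comp,
    ContinuousLinearMap.adjoint_inner_right]
  split_ifs with h
  · subst h
    exact (leftShiftIsometry j).inner_map_map g f
  · rw [zero_apply, inner_zero_right, lp.inner_eq_tsum]
    refine (tsum_congr fun σ => ?_).trans tsum_zero
    change inner ℂ (shiftCoeff j g σ) (shiftCoeff k f σ) = 0
    by_cases hj : ∃ τ : Word d, FreeMonoid.of j * τ = σ
    · have hk : ¬ ∃ τ : Word d, FreeMonoid.of k * τ = σ := by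
        rintro ⟨τ', rfl⟩
        obtain ⟨τ, hτ⟩ := hj
        exact h (List.cons.inj (congrArg FreeMonoid.toList hτ)).1
      rw [shiftCoeff, shiftCoeff, Function.extend_apply' _ _ _ hk]
      simp
    · rw [shiftCoeff, shiftCoeff, Function.extend_apply' _ _ _ hj]
      simp

theorem leftShiftPow_adjoint_mul_mem {d : ℕ} (σ τ : Word d) :
    ContinuousLinearMap.adjoint (leftShiftPow τ) * leftShiftPow σ ∈ ncDiscSystem d := by
  change star (leftShiftPow τ) * leftShiftPow σ ∈ ncDiscSystem d
  have one : leftShiftPow (1 : Word d) = 1 := map_one _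
  have cons (j : Fin d) (ρ : Word d) :
      leftShiftPow (FreeMonoid.of j * ρ) = leftShift j * leftShiftPow ρ := by
    rw [leftShiftPow, map_mul, FreeMonoid.lift_eval_of, leftShiftPow]
  induction τ using FreeMonoid.inductionOn' generalizing σ with
  | one => rw [one, star_one, one_mul]; exact leftShiftPow_mem σ
  | of_mul j τ ih =>
    induction σ using FreeMonoid.inductionOn' with
    | one => rw [one, mul_one]; exact leftShiftPow_adjoint_mem _
    | of_mul k σ _ =>
      rw [cons, cons, star_mul, mul_assoc, ← mul_assoc (star (leftShift j)),
        leftShift_adjoint_mul]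
      split_ifs
      · rw [one_mul]; exact ih σ
      · simp

/-! ### Kernels on the free monoid -/

/-- A kernel `K : 𝔽_d⁺ × 𝔽_d⁺ → ℂ` is positive if the matrix `[K(σ,τ)]_{σ,τ ⪯ σ₀}` is positive
semi-definite for every word `σ₀`. -/
def IsPositiveKernel {d : ℕ} (K : Word d → Word d → ℂ) : Prop :=
  ∀ σ₀ : Word d,
    (Matrix.of fun σ τ : {ρ : Word d // ρ.ShortlexLE σ₀} => K σ.1 τ.1).PosSemidef

/-- Multi-Toeplitz kernels: positive, invariant under left concatenation, and vanishing at pairs of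
words neither of which is a prefix of the other. -/
structure IsMultiToeplitz {d : ℕ} (K : Word d → Word d → ℂ) : Prop where
  positive : IsPositiveKernel K
  shift_invariant : ∀ τ σ σ' : Word d, K (τ * σ) (τ * σ') = K σ σ'
  vanishing : ∀ σ τ : Word d, (¬ ∃ α : Word d, σ = τ * α ∨ τ = σ * α) → K σ τ = 0

/-- The kernel `K_μ(σ,τ) = μ((L^τ)^* L^σ)` of a functional `μ` on the nc disc system. -/
noncomputable def kernelOf {d : ℕ} (μ : ncDiscSystem d →ₗ[ℂ] ℂ) (σ τ : Word d) : ℂ :=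
  μ ⟨ContinuousLinearMap.adjoint (leftShiftPow τ) * leftShiftPow σ,
    leftShiftPow_adjoint_mul_mem σ τ⟩

/-- The functional `μ` takes the values prescribed by the kernel `K`: `μ(L^σ) = K(σ,∅)` and
`μ((L^σ)^*) = K(∅,σ)` for all words `σ`. -/
def HasMoments {d : ℕ} (μ : ncDiscSystem d →ₗ[ℂ] ℂ) (K : Word d → Word d → ℂ) : Prop :=
  ∀ σ : Word d,
    μ ⟨leftShiftPow σ, leftShiftPow_mem σ⟩ = K σ 1 ∧
    μ ⟨ContinuousLinearMap.adjoint (leftShiftPow σ), leftShiftPow_adjoint_mem σ⟩ = K 1 σ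

/-!
The uniqueness assertions rest on two facts. The operators `L^σ` and `(L^σ)^*` span a dense
subspace of the nc disc system (`ncDiscSystem_le_of_isClosed`), so a continuous functional is
determined by its moments (`HasMoments.unique`); and an nc measure is automatically continuous,
as a positive functional on an operator system (`IsNCMeasure.exists_continuousLinearMap_eq`).
The kernel of an nc measure is multi-Toeplitz because its quadratic form is `μ (p(L)^* p(L))` and
because the `L_j` are isometries with pairwise orthogonal ranges.

For existence, let `K` be multi-Toeplitz. The functional is obtained as a limit of finite sums of
vector functionals `T ↦ ∑ ⟨f_i, T f_i⟩`, which are positive on all bounded operators. The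
vectors `f_i` come from a truncation followed by a Poisson transform.

* On words of length at most `N + 1`, factor `K(σ,τ) = ⟨v_τ, v_σ⟩` in a finite-dimensional space.
  Left invariance of `K` makes `v_σ ↦ v_{jσ}` isometric, and the vanishing condition makes the
  ranges for different `j` orthogonal. Extended by zero, these partial isometries form a row
  contraction `X` with `X^σ v_∅ = v_σ` (`IsMultiToeplitz.exists_rowContraction`).
* For `r < 1` put `Y = r X`. The Poisson kernel `h ↦ ∑ Z^σ ⊗ Δ (Y^σ)^* h`, with defect operator
  `Δ² = 1 - ∑ Y_j Y_j^*`, is an isometry that intertwines `Y_j^*` with `L_j^*`. Since the space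
  is finite-dimensional, the tensor product splits into finitely many copies of `ℍ²_d`
  (`exists_poisson`), and `r^{|σ|} K(σ,∅) = ⟨v_∅, Y^σ v_∅⟩` becomes `∑ ⟨f_i, L^σ f_i⟩`
  (`IsMultiToeplitz.exists_sum_inner_eq`).
* These functionals have norm at most `K(∅,∅)`. Letting `N → ∞` and `r → 1` along an ultrafilter
  gives a bounded positive functional with the moments of `K`
  (`IsMultiToeplitz.exists_positive_functional`).
-/

/-! ### Products of powers of the left free shift -/

theorem leftShiftPow_one {d : ℕ} : leftShiftPow (1 : Word d) = 1 := map_one _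

theorem leftShiftPow_mul {d : ℕ} (σ τ : Word d) :
    leftShiftPow (σ * τ) = leftShiftPow σ * leftShiftPow τ := map_mul _ _ _

theorem leftShiftPow_of {d : ℕ} (j : Fin d) : leftShiftPow (FreeMonoid.of j) = leftShift j :=
  FreeMonoid.lift_eval_of _ _

theorem star_leftShiftPow_mul_self {d : ℕ} (τ : Word d) :
    star (leftShiftPow τ) * leftShiftPow τ = 1 := by
  induction τ using FreeMonoid.inductionOn' with
  | one => simp [leftShiftPow_one]
  | of_mul j τ ih =>
    rw [leftShiftPow_mul, leftShiftPow_of, star_mul, mul_assoc, ← mul_assoc (star (leftShift j)),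
      leftShift_adjoint_mul, if_pos rfl, one_mul, ih]

/-- Powers of the shift along words that are not prefixes of one another have orthogonal ranges. -/
theorem star_leftShiftPow_mul_eq_zero {d : ℕ} (σ τ : Word d)
    (h : ¬ ∃ α : Word d, σ = τ * α ∨ τ = σ * α) :
    star (leftShiftPow τ) * leftShiftPow σ = 0 := by
  induction τ using FreeMonoid.inductionOn' generalizing σ with
  | one => exact absurd ⟨σ, Or.inl (one_mul σ).symm⟩ h
  | of_mul j τ ih =>
    induction σ using FreeMonoid.inductionOn' with
    | one => exact absurd ⟨_, Or.inr (one_mul _).symm⟩ h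
    | of_mul k σ _ =>
      rw [leftShiftPow_mul, leftShiftPow_mul, leftShiftPow_of, leftShiftPow_of, star_mul,
        mul_assoc, ← mul_assoc (star (leftShift j)), leftShift_adjoint_mul]
      split_ifs with hjk
      · subst hjk
        rw [one_mul]
        refine ih σ fun ⟨α, hα⟩ => h ⟨α, hα.imp ?_ ?_⟩
        · rintro rfl; rw [mul_assoc]
        · rintro rfl; rw [mul_assoc]
      · simp

/-! ### The nc disc system -/

theorem one_mem_ncDiscSystem (d : ℕ) : (1 : NCHardyOp d) ∈ ncDiscSystem d := by
  simpa [leftShiftPow_one] using leftShiftPow_mem (1 : Word d)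

theorem star_mem_ncDiscSystem {d : ℕ} {T : NCHardyOp d} (hT : T ∈ ncDiscSystem d) :
    star T ∈ ncDiscSystem d := by
  refine map_mem_closure (continuous_star (R := NCHardyOp d)) hT fun S hS => ?_
  obtain ⟨A, hA, B, hB, rfl⟩ := Submodule.mem_sup.1 hS
  rw [star_add]
  exact add_mem (Submodule.mem_sup_right ((Subalgebra.star_mem_star_iff _ _).2 hA))
    (Submodule.mem_sup_left hB)

theorem ncDiscAlgebra_le_of_isClosed {d : ℕ} (W : Submodule ℂ (NCHardyOp d))
    (hW : IsClosed (W : Set (NCHardyOp d))) (h : ∀ σ : Word d, leftShiftPow σ ∈ W) :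
    ∀ A ∈ ncDiscAlgebra d, A ∈ W := by
  intro A hA
  refine closure_minimal (t := (W : Set (NCHardyOp d))) ?_ hW hA
  rintro T hT
  have hT' : T ∈ Subalgebra.toSubmodule (Algebra.adjoin ℂ (Set.range (leftShift (d := d)))) := by
    rw [Algebra.adjoin_range_eq_range_freeAlgebra_lift]
    exact hT
  rw [Algebra.adjoin_eq_span, ← FreeMonoid.mrange_lift] at hT'
  refine Submodule.span_le.2 ?_ hT'
  rintro _ ⟨σ, rfl⟩
  exact h σ

/-- The linear span of the operators `L^σ` and `(L^σ)^*` is dense in the nc disc system: a closed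
subspace of operators that contains all of them contains the system. -/
theorem ncDiscSystem_le_of_isClosed {d : ℕ} (W : Submodule ℂ (NCHardyOp d))
    (hW : IsClosed (W : Set (NCHardyOp d))) (h : ∀ σ : Word d, leftShiftPow σ ∈ W)
    (h' : ∀ σ : Word d, star (leftShiftPow σ) ∈ W) : ncDiscSystem d ≤ W := by
  refine Submodule.topologicalClosure_minimal _ (sup_le ?_ ?_) hW
  · exact ncDiscAlgebra_le_of_isClosed W hW h
  · intro A hA
    have := ncDiscAlgebra_le_of_isClosed
      (W.comap (starLinearEquiv ℂ (A := NCHardyOp d) :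
        NCHardyOp d →ₗ⋆[ℂ] NCHardyOp d))
      (hW.preimage (continuous_star (R := NCHardyOp d))) h' (star A) hA
    simpa using this

/-! ### Positive functionals on operator systems -/

section OperatorSystem

variable {H : Type*} [NormedAddCommGroup H] [InnerProductSpace ℂ H] [CompleteSpace H]

theorem isPositive_norm_smul_one_sub {T : H →L[ℂ] H} (hT : IsSelfAdjoint T) :
    (((‖T‖ : ℝ) : ℂ) • (1 : H →L[ℂ] H) - T).IsPositive := by
  refine ContinuousLinearMap.isPositive_def'.2 ⟨?_, fun x => ?_⟩
  · refine IsSelfAdjoint.sub ?_ hT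
    rw [isSelfAdjoint_iff, star_smul, star_one]
    simp
  · have h1 : (inner ℂ (T x) x).re ≤ ‖T‖ * ‖x‖ * ‖x‖ :=
      (Complex.re_le_norm _).trans ((norm_inner_le_norm _ _).trans
        (by gcongr; exact T.le_opNorm x))
    have h2 : (inner ℂ x x).re = ‖x‖ ^ 2 := inner_self_eq_norm_sq (𝕜 := ℂ) x
    change 0 ≤ (inner ℂ (((‖T‖ : ℝ) : ℂ) • x - T x) x).re
    rw [inner_sub_left, inner_smul_left, Complex.conj_ofReal, Complex.sub_re,
      Complex.re_ofReal_mul, h2]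
    linarith

variable {S : Submodule ℂ (H →L[ℂ] H)} {μ : S →ₗ[ℂ] ℂ}

/-- A positive functional is real and bounded by its value at `1` on self-adjoint operators, since
`‖T‖ 1 ± T` is positive. -/
theorem im_eq_zero_and_abs_re_le_of_positive (h1 : 1 ∈ S)
    (hμ : ∀ f : S, (f : H →L[ℂ] H).IsPositive → 0 ≤ μ f) (T : S)
    (hT : IsSelfAdjoint (T : H →L[ℂ] H)) :
    (μ T).im = 0 ∧ |(μ T).re| ≤ (μ ⟨1, h1⟩).re * ‖T‖ := by
  have key : ∀ R : S, IsSelfAdjoint (R : H →L[ℂ] H) →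
      0 ≤ ((‖R‖ : ℝ) : ℂ) * μ ⟨1, h1⟩ - μ R := by
    intro R hR
    have := hμ (((‖R‖ : ℝ) : ℂ) • (⟨1, h1⟩ : S) - R) (isPositive_norm_smul_one_sub hR)
    rwa [map_sub, map_smul, smul_eq_mul] at this
  have h1 : 0 ≤ μ ⟨1, h1⟩ := hμ _ ContinuousLinearMap.isPositive_one
  have h2 := key T hT
  have h3 := key (-T) hT.neg
  rw [norm_neg, map_neg] at h3
  rw [Complex.nonneg_iff] at h1 h2 h3
  simp only [Complex.sub_re, Complex.sub_im, Complex.neg_re, Complex.neg_im,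
    Complex.re_ofReal_mul, Complex.im_ofReal_mul] at h2 h3
  rw [← h1.2] at h2
  refine ⟨by linarith [h2.2], abs_le.2 ⟨by linarith, by linarith⟩⟩

/-- A positive functional on an operator system is Hermitian and bounded: both facts follow from the
self-adjoint case, applied to `T + T^*` and `i (T - T^*)`. -/
theorem map_star_and_norm_le_of_positive (h1 : 1 ∈ S) (hS : ∀ T ∈ S, star T ∈ S)
    (hμ : ∀ f : S, (f : H →L[ℂ] H).IsPositive → 0 ≤ μ f) (T : S) :
    μ ⟨star (T : H →L[ℂ] H), hS _ T.2⟩ = star (μ T) ∧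
      ‖μ T‖ ≤ 2 * (μ ⟨1, h1⟩).re * ‖T‖ := by
  have h0 : 0 ≤ (μ ⟨1, h1⟩).re :=
    (Complex.nonneg_iff.1 (hμ _ ContinuousLinearMap.isPositive_one)).1
  set T' : S := ⟨star (T : H →L[ℂ] H), hS _ T.2⟩ with hT'
  have hn : ‖T'‖ = ‖T‖ := norm_star (T : H →L[ℂ] H)
  obtain ⟨i1, a1⟩ := im_eq_zero_and_abs_re_le_of_positive h1 hμ (T + T') (by
    change star ((T : H →L[ℂ] H) + star (T : H →L[ℂ] H)) = _
    rw [star_add, star_star, add_comm]; rfl)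
  obtain ⟨i2, a2⟩ := im_eq_zero_and_abs_re_le_of_positive h1 hμ (Complex.I • (T - T')) (by
    change star (Complex.I • ((T : H →L[ℂ] H) - star (T : H →L[ℂ] H))) = _
    rw [star_smul, star_sub, star_star]
    change _ = Complex.I • ((T : H →L[ℂ] H) - star (T : H →L[ℂ] H))
    simp [← smul_neg])
  rw [map_add, Complex.add_im] at i1
  rw [map_smul, map_sub, smul_eq_mul, Complex.I_mul_im, Complex.sub_re] at i2
  have hs : μ T' = star (μ T) := by
    apply Complex.ext
    · simp; linarith
    · simp; linarith
  refine ⟨hs, ?_⟩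
  have e1 : (μ (T + T')).re = 2 * (μ T).re := by
    rw [map_add, hs]; simp; ring
  have e2 : (μ (Complex.I • (T - T'))).re = - (2 * (μ T).im) := by
    rw [map_smul, map_sub, hs]; simp; ring
  have n1 : ‖T + T'‖ ≤ 2 * ‖T‖ := (norm_add_le T T').trans (by linarith)
  have n2 : ‖Complex.I • (T - T')‖ ≤ 2 * ‖T‖ := by
    rw [norm_smul, Complex.norm_I, one_mul]
    exact (norm_sub_le T T').trans (by linarith)
  rw [e1, abs_mul, abs_two] at a1
  rw [e2, abs_neg, abs_mul, abs_two] at a2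
  have b1 := a1.trans (mul_le_mul_of_nonneg_left n1 h0)
  have b2 := a2.trans (mul_le_mul_of_nonneg_left n2 h0)
  linarith [Complex.norm_le_abs_re_add_abs_im (μ T)]

end OperatorSystem

namespace IsNCMeasure

variable {d : ℕ} {μ : ncDiscSystem d →ₗ[ℂ] ℂ}

theorem map_star (hμ : IsNCMeasure μ) (T : ncDiscSystem d) :
    μ ⟨star (T : NCHardyOp d), star_mem_ncDiscSystem T.2⟩ = star (μ T) :=
  (map_star_and_norm_le_of_positive (one_mem_ncDiscSystem d)
    (fun _ => star_mem_ncDiscSystem) hμ T).1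

theorem norm_apply_le (hμ : IsNCMeasure μ) (T : ncDiscSystem d) :
    ‖μ T‖ ≤ 2 * (μ ⟨1, one_mem_ncDiscSystem d⟩).re * ‖T‖ :=
  (map_star_and_norm_le_of_positive (one_mem_ncDiscSystem d)
    (fun _ => star_mem_ncDiscSystem) hμ T).2

/-- nc measures are automatically bounded, as positive functionals on an operator system. -/
theorem exists_continuousLinearMap_eq (hμ : IsNCMeasure μ) :
    ∃ ν : ncDiscSystem d →L[ℂ] ℂ, (ν : ncDiscSystem d →ₗ[ℂ] ℂ) = μ :=
  ⟨μ.mkContinuous _ hμ.norm_apply_le, rfl⟩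

end IsNCMeasure

/-- A continuous functional on the nc disc system is determined by its moments. -/
theorem HasMoments.unique {d : ℕ} {K : Word d → Word d → ℂ} {μ ν : ncDiscSystem d →L[ℂ] ℂ}
    (hμ : HasMoments (μ : ncDiscSystem d →ₗ[ℂ] ℂ) K)
    (hν : HasMoments (ν : ncDiscSystem d →ₗ[ℂ] ℂ) K) : μ = ν := by
  obtain ⟨φ, hφ, -⟩ := exists_extension_norm_eq (ncDiscSystem d) (μ - ν)
  have h := ncDiscSystem_le_of_isClosed φ.ker φ.isClosed_ker
    (fun σ => by
      refine (hφ ⟨_, leftShiftPow_mem σ⟩).trans (sub_eq_zero.2 ?_)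
      exact (hμ σ).1.trans (hν σ).1.symm)
    (fun σ => by
      refine (hφ ⟨_, leftShiftPow_adjoint_mem σ⟩).trans (sub_eq_zero.2 ?_)
      exact (hμ σ).2.trans (hν σ).2.symm)
  refine ContinuousLinearMap.ext fun T => sub_eq_zero.1 ?_
  exact (hφ T).symm.trans (h T.2)

/-! ### The kernel of an nc measure -/

theorem hasMoments_kernelOf {d : ℕ} (μ : ncDiscSystem d →ₗ[ℂ] ℂ) : HasMoments μ (kernelOf μ) := by
  refine fun σ => ⟨congrArg μ (Subtype.ext ?_), congrArg μ (Subtype.ext ?_)⟩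
  · change _ = star (leftShiftPow 1) * _
    rw [leftShiftPow_one, star_one, one_mul]
  · change _ = _ * leftShiftPow 1
    rw [leftShiftPow_one, mul_one]

theorem kernelOf_mul_mul {d : ℕ} (μ : ncDiscSystem d →ₗ[ℂ] ℂ) (τ σ σ' : Word d) :
    kernelOf μ (τ * σ) (τ * σ') = kernelOf μ σ σ' := by
  refine congrArg μ (Subtype.ext ?_)
  change star (leftShiftPow (τ * σ')) * leftShiftPow (τ * σ) =
    star (leftShiftPow σ') * leftShiftPow σ
  rw [leftShiftPow_mul, leftShiftPow_mul, star_mul, mul_assoc, ← mul_assoc (star (leftShiftPow τ)),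
    star_leftShiftPow_mul_self, one_mul]

theorem kernelOf_eq_zero {d : ℕ} (μ : ncDiscSystem d →ₗ[ℂ] ℂ) (σ τ : Word d)
    (h : ¬ ∃ α : Word d, σ = τ * α ∨ τ = σ * α) : kernelOf μ σ τ = 0 :=
  (congrArg μ (Subtype.ext (star_leftShiftPow_mul_eq_zero σ τ h))).trans (map_zero μ)

/-- The quadratic form of `kernelOf μ` at `x` is the value of `μ` at `p^* p`, where
`p = ∑ conj (x σ) L^σ`. -/
theorem IsNCMeasure.isPositiveKernel_kernelOf {d : ℕ} {μ : ncDiscSystem d →ₗ[ℂ] ℂ}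
    (hμ : IsNCMeasure μ) : IsPositiveKernel (kernelOf μ) := by
  refine fun σ₀ => ⟨?_, fun x => ?_⟩
  · ext σ τ
    change star (kernelOf μ τ.1 σ.1) = kernelOf μ σ.1 τ.1
    rw [kernelOf, ← hμ.map_star]
    refine congrArg μ (Subtype.ext ?_)
    change star (star (leftShiftPow σ.1) * leftShiftPow τ.1) = star (leftShiftPow τ.1) * _
    rw [star_mul, star_star]
  · set p : NCHardyOp d := x.sum fun σ c => star c • leftShiftPow σ.1 with hp
    set F : ncDiscSystem d := x.sum fun σ c => x.sum fun τ c' => (star c * c') •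
      ⟨ContinuousLinearMap.adjoint (leftShiftPow τ.1) * leftShiftPow σ.1,
        leftShiftPow_adjoint_mul_mem σ.1 τ.1⟩ with hF
    have hFp : (F : NCHardyOp d) = star p * p := by
      rw [hF, hp]
      simp only [Finsupp.sum, Submodule.coe_sum, Submodule.coe_smul, star_sum, star_smul,
        star_star, Finset.sum_mul_sum]
      rw [Finset.sum_comm]
      refine Finset.sum_congr rfl fun σ _ => Finset.sum_congr rfl fun τ _ => ?_
      rw [smul_mul_smul_comm, mul_comm]
      rfl
    have h := hμ F (by rw [hFp]; exact ContinuousLinearMap.isPositive_adjoint_comp_self p)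
    convert h using 1
    rw [hF]
    simp only [Finsupp.sum, map_sum, map_smul, smul_eq_mul]
    refine Finset.sum_congr rfl fun σ _ => Finset.sum_congr rfl fun τ _ => ?_
    rw [mul_right_comm]
    rfl

theorem IsNCMeasure.isMultiToeplitz_kernelOf {d : ℕ} {μ : ncDiscSystem d →ₗ[ℂ] ℂ}
    (hμ : IsNCMeasure μ) : IsMultiToeplitz (kernelOf μ) :=
  ⟨hμ.isPositiveKernel_kernelOf, kernelOf_mul_mul μ, kernelOf_eq_zero μ⟩

/-! ### Row contractions -/

section RowContraction

variable {E : Type*} [NormedAddCommGroup E] [InnerProductSpace ℂ E] [CompleteSpace E]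

open ContinuousLinearMap in
/-- Contractions with pairwise orthogonal ranges form a row contraction. -/
theorem sum_norm_sq_adjoint_le {ι : Type*} [Fintype ι] (X : ι → E →L[ℂ] E)
    (hX : ∀ j x, ‖X j x‖ ≤ ‖x‖) (horth : ∀ j k, j ≠ k → ∀ x y, inner ℂ (X j x) (X k y) = 0)
    (h : E) : ∑ j, ‖adjoint (X j) h‖ ^ 2 ≤ ‖h‖ ^ 2 := by
  -- With `y = ∑ X_j X_j^* h` and `s = ∑ ‖X_j^* h‖²`, one has `‖y‖² ≤ s = ⟨y, h⟩ ≤ ‖y‖ ‖h‖`.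
  set y : E := ∑ j, X j (adjoint (X j) h) with hy
  set s : ℝ := ∑ j, ‖adjoint (X j) h‖ ^ 2 with hs
  have h1 : inner ℂ y h = (s : ℂ) := by
    rw [hy, sum_inner, hs, Complex.ofReal_sum]
    refine Finset.sum_congr rfl fun j _ => ?_
    rw [← adjoint_inner_right, inner_self_eq_norm_sq_to_K, Complex.ofReal_pow]
    rfl
  have h2 : ‖y‖ ^ 2 ≤ s := by
    have h3 : ((‖y‖ ^ 2 : ℝ) : ℂ) = ((∑ j, ‖X j (adjoint (X j) h)‖ ^ 2 : ℝ) : ℂ) := by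
      have : inner ℂ y y = ((‖y‖ ^ 2 : ℝ) : ℂ) := by
        rw [inner_self_eq_norm_sq_to_K, Complex.ofReal_pow]; rfl
      rw [← this]
      nth_rewrite 1 [hy]
      rw [sum_inner, Complex.ofReal_sum]
      refine Finset.sum_congr rfl fun j _ => ?_
      rw [hy, inner_sum, Finset.sum_eq_single j
        (fun k _ hk => horth j k hk.symm _ _) (by simp),
        inner_self_eq_norm_sq_to_K, Complex.ofReal_pow]
      rfl
    rw [Complex.ofReal_inj.1 h3]
    exact Finset.sum_le_sum fun j _ => by gcongr; exact hX _ _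
  have h4 : s ≤ ‖y‖ * ‖h‖ := by
    have := norm_inner_le_norm (𝕜 := ℂ) y h
    rw [h1] at this
    exact (Complex.re_le_norm (s : ℂ)).trans this
  nlinarith [sq_nonneg (‖y‖ - ‖h‖)]

open ContinuousLinearMap in
/-- The defect operator `Δ = (1 - ∑ Y_j Y_j^*)^{1/2}` of a row contraction. -/
theorem exists_defect {ι : Type*} [Fintype ι] (Y : ι → E →L[ℂ] E)
    (hY : ∀ h, ∑ j, ‖adjoint (Y j) h‖ ^ 2 ≤ ‖h‖ ^ 2) :
    ∃ D : E →L[ℂ] E, ∀ h, ‖D h‖ ^ 2 + ∑ j, ‖adjoint (Y j) h‖ ^ 2 = ‖h‖ ^ 2 := by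
  set Q : E →L[ℂ] E := 1 - ∑ j, Y j * star (Y j) with hQ
  have hre : ∀ h, (inner ℂ (Q h) h).re = ‖h‖ ^ 2 - ∑ j, ‖adjoint (Y j) h‖ ^ 2 := by
    intro h
    have e : ∀ x : E, (inner ℂ x x).re = ‖x‖ ^ 2 := fun x =>
      inner_self_eq_norm_sq (𝕜 := ℂ) x
    have : Q h = h - ∑ j, Y j (adjoint (Y j) h) := by
      simp [hQ, ContinuousLinearMap.star_eq_adjoint]
    rw [this, inner_sub_left, sum_inner, Complex.sub_re, e, Complex.re_sum]
    congr 1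
    refine Finset.sum_congr rfl fun j _ => ?_
    rw [← adjoint_inner_right, e]
  have hpos : Q.IsPositive := by
    refine isPositive_def'.2 ⟨?_, fun h => ?_⟩
    · refine (IsSelfAdjoint.one _).sub ?_
      exact isSelfAdjoint_sum _ fun j _ => IsSelfAdjoint.mul_star_self _
    · exact (sub_nonneg.2 (hY h)).trans_eq (hre h).symm
  obtain ⟨D, hD⟩ := CStarAlgebra.nonneg_iff_eq_star_mul_self.1 ((nonneg_iff_isPositive Q).2 hpos)
  refine ⟨D, fun h => ?_⟩
  have h1 : (inner ℂ (Q h) h).re = ‖D h‖ ^ 2 := by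
    rw [hD]
    change (inner ℂ (adjoint D (D h)) h).re = _
    rw [adjoint_inner_left]
    exact inner_self_eq_norm_sq (𝕜 := ℂ) (D h)
  linarith [hre h]

omit [CompleteSpace E] in
/-- If `‖B c‖ = ‖A c‖` for all `c`, then `A c ↦ B c` is an isometry on the range of `A`, and it
extends to a partial isometry that vanishes on the orthogonal complement of that range. -/
theorem exists_partialIsometry [FiniteDimensional ℂ E] {V : Type*} [AddCommGroup V] [Module ℂ V]
    (A B : V →ₗ[ℂ] E) (h : ∀ c, ‖B c‖ = ‖A c‖) :
    ∃ X : E →L[ℂ] E, (∀ c, X (A c) = B c) ∧ ∀ x, ∃ c, X x = B c ∧ ‖B c‖ ≤ ‖x‖ := by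
  -- `X` is `B ∘ s ∘ P`, with `P` the projection onto the range of `A` and `s` a section of `A`.
  obtain ⟨s, hs⟩ := A.rangeRestrict.exists_rightInverse_of_surjective A.range_rangeRestrict
  have hs' : ∀ y, A (s y) = y := fun y => congrArg Subtype.val (LinearMap.congr_fun hs y)
  refine ⟨(B ∘ₗ s ∘ₗ (A.range.orthogonalProjectionOnto : E →ₗ[ℂ] A.range)).toContinuousLinearMap,
    fun c => ?_, fun x => ⟨s (A.range.orthogonalProjectionOnto x), rfl, ?_⟩⟩
  · have h0 : B (s ⟨A c, c, rfl⟩ - c) = 0 := by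
      rw [← norm_eq_zero, h, map_sub, hs', sub_self, norm_zero]
    have h1 : A.range.orthogonalProjectionOnto (A c) = ⟨A c, c, rfl⟩ :=
      Submodule.orthogonalProjectionOnto_mem_subspace_eq_self (⟨A c, c, rfl⟩ : A.range)
    change B (s (A.range.orthogonalProjectionOnto (A c))) = _
    rw [h1, ← sub_eq_zero, ← map_sub, h0]
  · rw [h, hs']
    exact A.range.norm_orthogonalProjectionOnto_apply_le x

end RowContraction

/-! ### Words of bounded length -/

open scoped Classical in
/-- The finite set of words of length at most `n`, built by prepending letters so that sums over it
satisfy the recursion `Word.sum_upTo_succ`. -/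
noncomputable def Word.upTo (d : ℕ) : ℕ → Finset (Word d)
  | 0 => {1}
  | n + 1 => insert 1 ((Finset.univ ×ˢ Word.upTo d n).image fun p => FreeMonoid.of p.1 * p.2)

theorem Word.mem_upTo {d n : ℕ} {σ : Word d} : σ ∈ Word.upTo d n ↔ σ.length ≤ n := by
  induction n generalizing σ with
  | zero => simp [Word.upTo, FreeMonoid.length_eq_zero]
  | succ n ih =>
    cases σ using FreeMonoid.casesOn with
    | one => simp [Word.upTo]
    | of_mul j σ =>
      simp only [Word.upTo, Finset.mem_insert, Finset.mem_image, Finset.mem_product,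
        Finset.mem_univ, true_and, Prod.exists, FreeMonoid.length_mul, FreeMonoid.length_of]
      constructor
      · rintro (h | ⟨k, τ, hτ, h⟩)
        · exact absurd (congrArg FreeMonoid.length h) (by simp)
        · have := congrArg FreeMonoid.length h
          simp only [FreeMonoid.length_mul, FreeMonoid.length_of] at this
          have := ih.1 hτ
          omega
      · exact fun h => Or.inr ⟨j, σ, ih.2 (by omega), rfl⟩

theorem Word.sum_upTo_succ {d : ℕ} {M : Type*} [AddCommMonoid M] (f : Word d → M) (n : ℕ) :
    ∑ σ ∈ Word.upTo d (n + 1), f σ =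
      f 1 + ∑ j : Fin d, ∑ σ ∈ Word.upTo d n, f (FreeMonoid.of j * σ) := by
  classical
  rw [Word.upTo, Finset.sum_insert, Finset.sum_image, Finset.sum_product]
  · rintro ⟨j, σ⟩ - ⟨k, τ⟩ - h
    have := List.cons.inj (congrArg FreeMonoid.toList h)
    exact Prod.ext this.1 this.2
  · simp only [Finset.mem_image, not_exists, not_and]
    intro p _ h
    exact absurd (congrArg FreeMonoid.length h) (by simp)

theorem Word.hasSum_of_tendsto_upTo {d : ℕ} {f : Word d → ℝ} {a : ℝ} (hf : ∀ σ, 0 ≤ f σ)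
    (hle : ∀ n, ∑ σ ∈ Word.upTo d n, f σ ≤ a)
    (ha : Filter.Tendsto (fun n => ∑ σ ∈ Word.upTo d n, f σ) Filter.atTop (nhds a)) :
    HasSum f a := by
  have hs : Summable f := summable_of_sum_le hf fun s => by
    refine (Finset.sum_le_sum_of_subset_of_nonneg (t := Word.upTo d (s.sup FreeMonoid.length))
      (fun σ hσ => Word.mem_upTo.2 (Finset.le_sup hσ)) fun σ _ _ => hf σ).trans (hle _)
  have hU : Filter.Tendsto (Word.upTo d) Filter.atTop Filter.atTop :=
    Filter.tendsto_atTop_finset_of_monotone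
      (fun m n hmn σ hσ => Word.mem_upTo.2 ((Word.mem_upTo.1 hσ).trans hmn))
      fun σ => ⟨σ.length, Word.mem_upTo.2 le_rfl⟩
  rw [← tendsto_nhds_unique (hs.hasSum.comp hU) ha]
  exact hs.hasSum

/-! ### The Poisson kernel of a strict row contraction -/

/-- The backward shift `L_j^*` deletes a leading letter `j`. -/
theorem adjoint_leftShift_apply {d : ℕ} (j : Fin d) (f : NCHardy d) (σ : Word d) :
    ContinuousLinearMap.adjoint (leftShift j) f σ = f (FreeMonoid.of j * σ) := by
  classical
  have h1 : leftShift j (lp.single (E := fun _ : Word d => ℂ) 2 σ (1 : ℂ)) =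
      lp.single (E := fun _ : Word d => ℂ) 2 (FreeMonoid.of j * σ) (1 : ℂ) := by
    ext τ
    change shiftCoeff j _ τ = _
    by_cases h : ∃ ρ : Word d, FreeMonoid.of j * ρ = τ
    · obtain ⟨ρ, rfl⟩ := h
      rw [shiftCoeff, (Word.of_mul_injective j).extend_apply, lp.single_apply, lp.single_apply]
      simp [Pi.single_apply]
    · rw [shiftCoeff, Function.extend_apply' _ _ _ h, lp.single_apply, Pi.single_apply, if_neg]
      · rfl
      · rintro rfl
        exact h ⟨σ, rfl⟩
  have h2 := ContinuousLinearMap.adjoint_inner_right (leftShift j) (lp.single (E := fun _ : Word d => ℂ) 2 σ (1 : ℂ)) f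
  rw [h1, lp.inner_single_left, lp.inner_single_left] at h2
  simpa using h2

/-- Polarization: maps that are jointly isometric jointly preserve inner products. -/
theorem sum_inner_eq_of_sum_norm_sq {E F ι : Type*} [NormedAddCommGroup E] [InnerProductSpace ℂ E]
    [NormedAddCommGroup F] [InnerProductSpace ℂ F] [Fintype ι] (P : ι → E →ₗ[ℂ] F)
    (hP : ∀ h, ∑ i, ‖P i h‖ ^ 2 = ‖h‖ ^ 2) (h k : E) :
    ∑ i, inner ℂ (P i h) (P i k) = inner ℂ h k := by
  have hP' : ∀ h, ∑ i, (RCLike.ofReal ‖P i h‖ : ℂ) ^ 2 = (RCLike.ofReal ‖h‖ : ℂ) ^ 2 := fun h =>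
    by simp only [← RCLike.ofReal_pow, ← RCLike.ofReal_sum, hP]
  simp only [inner_eq_sum_norm_sq_div_four, ← map_add, ← map_sub, ← map_smul, ← Finset.sum_div,
    Finset.sum_add_distrib, Finset.sum_sub_distrib, ← Finset.sum_mul, hP']

section Poisson

variable {d : ℕ} {E : Type*} [NormedAddCommGroup E] [InnerProductSpace ℂ E] [CompleteSpace E]

open ContinuousLinearMap in
/-- The Poisson kernel `h ↦ ∑ Z^σ ⊗ Δ (Y^σ)^* h` of a strict row contraction is isometric. Strictness
(`q < 1`) makes the remainders of the partial sums tend to zero. -/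
theorem hasSum_norm_sq_defect (Y : Fin d → E →L[ℂ] E) (D : E →L[ℂ] E) {q : ℝ} (hq0 : 0 ≤ q)
    (hq : q < 1) (hY : ∀ h, ∑ j, ‖adjoint (Y j) h‖ ^ 2 ≤ q * ‖h‖ ^ 2)
    (hD : ∀ h, ‖D h‖ ^ 2 + ∑ j, ‖adjoint (Y j) h‖ ^ 2 = ‖h‖ ^ 2) (h : E) :
    HasSum (fun σ : Word d => ‖D (adjoint (FreeMonoid.lift Y σ) h)‖ ^ 2) (‖h‖ ^ 2) := by
  -- The remainders of the partial sums satisfy `R (n + 1) h = ∑ j, R n (Y_j^* h)`.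
  have key : ∀ n h, ∑ σ ∈ Word.upTo d n, ‖D (adjoint (FreeMonoid.lift Y σ) h)‖ ^ 2 ≤ ‖h‖ ^ 2 ∧
      ‖h‖ ^ 2 - q ^ (n + 1) * ‖h‖ ^ 2 ≤
        ∑ σ ∈ Word.upTo d n, ‖D (adjoint (FreeMonoid.lift Y σ) h)‖ ^ 2 := by
    intro n
    induction n with
    | zero =>
      intro h
      simp only [Word.upTo, Finset.sum_singleton, map_one, zero_add, pow_one]
      have : adjoint (1 : E →L[ℂ] E) h = h := by
        rw [← star_eq_adjoint, star_one]; rfl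
      rw [this]
      have h1 : 0 ≤ ∑ j, ‖adjoint (Y j) h‖ ^ 2 := Finset.sum_nonneg fun _ _ => sq_nonneg _
      exact ⟨by linarith [hD h], by linarith [hD h, hY h]⟩
    | succ n ih =>
      intro h
      rw [Word.sum_upTo_succ]
      have e1 : adjoint (FreeMonoid.lift Y (1 : Word d)) h = h := by
        rw [map_one, ← star_eq_adjoint, star_one]; rfl
      have e2 : ∀ (j : Fin d) (σ : Word d), adjoint (FreeMonoid.lift Y (FreeMonoid.of j * σ)) h =
          adjoint (FreeMonoid.lift Y σ) (adjoint (Y j) h) := fun j σ => by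
        rw [map_mul, FreeMonoid.lift_eval_of, ← star_eq_adjoint, star_mul]; rfl
      simp only [e1, e2]
      have u := Finset.sum_le_sum fun j (_ : j ∈ Finset.univ) => (ih (adjoint (Y j) h)).1
      have l := Finset.sum_le_sum fun j (_ : j ∈ Finset.univ) => (ih (adjoint (Y j) h)).2
      rw [Finset.sum_sub_distrib, ← Finset.mul_sum] at l
      have b := mul_le_mul_of_nonneg_left (hY h) (pow_nonneg hq0 (n + 1))
      rw [pow_succ q (n + 1), mul_assoc]
      exact ⟨by linarith [hD h], by linarith [hD h]⟩
  refine Word.hasSum_of_tendsto_upTo (fun _ => sq_nonneg _) (fun n => (key n h).1) ?_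
  refine tendsto_of_tendsto_of_tendsto_of_le_of_le ?_ tendsto_const_nhds
    (fun n => (key n h).2) fun n => (key n h).1
  have := ((tendsto_pow_atTop_nhds_zero_of_lt_one hq0 hq).comp
    (Filter.tendsto_add_atTop_nat 1)).mul_const (‖h‖ ^ 2)
  simpa using this.const_sub (‖h‖ ^ 2)

open ContinuousLinearMap in
/-- The Poisson kernel of a strict row contraction `Y`, split into its components along an
orthonormal basis `e`: the maps `P_i h = ∑ ⟨e_i, Δ (Y^σ)^* h⟩ Z^σ` intertwine `Y_j^*` with
`L_j^*`, and together they form an isometry. -/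
theorem exists_poisson {ι : Type*} [Fintype ι] (e : OrthonormalBasis ι ℂ E)
    (Y : Fin d → E →L[ℂ] E) {q : ℝ} (hq0 : 0 ≤ q)
    (hq : q < 1) (hY : ∀ h, ∑ j, ‖adjoint (Y j) h‖ ^ 2 ≤ q * ‖h‖ ^ 2) :
    ∃ P : ι → E →ₗ[ℂ] NCHardy d, (∀ h, ∑ i, ‖P i h‖ ^ 2 = ‖h‖ ^ 2) ∧
      ∀ i j h, adjoint (leftShift j) (P i h) = P i (adjoint (Y j) h) := by
  obtain ⟨D, hD⟩ := exists_defect Y fun h => (hY h).trans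
    (mul_le_of_le_one_left (sq_nonneg _) hq.le)
  have hsum := hasSum_norm_sq_defect Y D hq0 hq hY hD
  have h2 : 0 < (2 : ENNReal).toReal := by norm_num
  have hpow : ∀ x : ℝ, x ^ (2 : ENNReal).toReal = x ^ 2 := fun x => by simp
  have hmem : ∀ i h, Memℓp (fun σ : Word d =>
      inner ℂ (e i) (D (adjoint (FreeMonoid.lift Y σ) h))) 2 := fun i h => by
    refine (memℓp_gen_iff h2).2 (Summable.of_nonneg_of_le (fun _ => by positivity)
      (fun σ => ?_) (hsum h).summable)
    rw [hpow]
    gcongr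
    simpa using norm_inner_le_norm (𝕜 := ℂ) (e i) (D (adjoint (FreeMonoid.lift Y σ) h))
  refine ⟨fun i =>
    { toFun := fun h => ⟨_, hmem i h⟩
      map_add' := fun h k => by
        ext σ
        change inner ℂ (e i) _ = inner ℂ (e i) _ + inner ℂ (e i) _
        rw [map_add, map_add, inner_add_right]
      map_smul' := fun c h => by
        ext σ
        change inner ℂ (e i) _ = c * inner ℂ (e i) _
        rw [map_smul, map_smul, inner_smul_right] }, fun h => ?_, fun i j h => ?_⟩
  · have h3 := hasSum_sum fun i (_ : i ∈ Finset.univ) =>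
      lp.hasSum_norm h2 (⟨_, hmem i h⟩ : NCHardy d)
    simp only [hpow] at h3
    refine h3.unique ?_
    convert hsum h using 2 with σ
    exact e.sum_sq_norm_inner_right _
  · ext σ
    rw [adjoint_leftShift_apply]
    change inner ℂ (e i) _ = inner ℂ (e i) _
    rw [map_mul, FreeMonoid.lift_eval_of, ← star_eq_adjoint, star_mul]
    rfl

open ContinuousLinearMap in
/-- Every vector functional `Y^σ ↦ ⟨h, Y^σ h⟩` of a strict row contraction on a finite-dimensional
space is a finite sum of vector functionals of the left free shift. -/
theorem exists_sum_inner_leftShiftPow_eq [FiniteDimensional ℂ E]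
    (Y : Fin d → E →L[ℂ] E) {q : ℝ} (hq0 : 0 ≤ q)
    (hq : q < 1) (hY : ∀ h, ∑ j, ‖adjoint (Y j) h‖ ^ 2 ≤ q * ‖h‖ ^ 2) (h : E) :
    ∃ (m : ℕ) (f : Fin m → NCHardy d), ∀ σ : Word d,
      ∑ i, inner ℂ (f i) (leftShiftPow σ (f i)) = inner ℂ h (FreeMonoid.lift Y σ h) := by
  obtain ⟨P, hP, hPY⟩ := exists_poisson (stdOrthonormalBasis ℂ E) Y hq0 hq hY
  have hPY' : ∀ i (σ : Word d) k,
      adjoint (leftShiftPow σ) (P i k) = P i (adjoint (FreeMonoid.lift Y σ) k) := by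
    intro i σ
    induction σ using FreeMonoid.inductionOn' with
    | one =>
      intro k
      rw [leftShiftPow_one, map_one (FreeMonoid.lift Y), ← star_eq_adjoint, ← star_eq_adjoint, star_one, star_one]
      rfl
    | of_mul j σ ih =>
      intro k
      rw [leftShiftPow_mul, map_mul (FreeMonoid.lift Y), leftShiftPow_of, FreeMonoid.lift_eval_of,
        ← star_eq_adjoint, ← star_eq_adjoint, star_mul, star_mul]
      change adjoint (leftShiftPow σ) (adjoint (leftShift j) (P i k)) =
        P i (adjoint (FreeMonoid.lift Y σ) (adjoint (Y j) k))
      rw [hPY, ih]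
  refine ⟨_, fun i => P i h, fun σ => ?_⟩
  rw [← adjoint_inner_left, ← sum_inner_eq_of_sum_norm_sq P hP]
  refine Finset.sum_congr rfl fun i _ => ?_
  rw [← adjoint_inner_left, hPY']

end Poisson

/-! ### Realizing truncated multi-Toeplitz kernels by row contractions -/

/-- Every finite set of words lies in a shortlex initial segment, so that positivity of a kernel
applies to arbitrary finite sets. -/
theorem Word.exists_forall_shortlexLE {d : ℕ} (s : Finset (Word d)) :
    ∃ σ₀ : Word d, ∀ σ ∈ s, σ.ShortlexLE σ₀ := by
  cases d with
  | zero => exact ⟨1, fun σ _ => Or.inr (Subsingleton.elim (α := List (Fin 0)) _ _)⟩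
  | succ d =>
    refine ⟨FreeMonoid.ofList (List.replicate (s.sup FreeMonoid.length + 1) 0), fun σ hσ =>
      Or.inl (List.Shortlex.of_length_lt ?_)⟩
    have : σ.length ≤ s.sup FreeMonoid.length := Finset.le_sup hσ
    rw [FreeMonoid.toList_ofList, List.length_replicate]
    exact Nat.lt_succ_of_le this

open scoped MatrixOrder Matrix.Norms.L2Operator in
/-- Kolmogorov decomposition of a positive kernel on a finite set of words. -/
theorem IsPositiveKernel.exists_inner_eq {d : ℕ} {K : Word d → Word d → ℂ}
    (hK : IsPositiveKernel K) (s : Finset (Word d)) :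
    ∃ v : Word d → EuclideanSpace ℂ s, ∀ σ ∈ s, ∀ τ ∈ s, inner ℂ (v τ) (v σ) = K σ τ := by
  classical
  obtain ⟨σ₀, hσ₀⟩ := Word.exists_forall_shortlexLE s
  have hM := ((hK σ₀).submatrix fun σ : s => ⟨σ.1, hσ₀ σ.1 σ.2⟩).transpose
  obtain ⟨B, hB⟩ := CStarAlgebra.nonneg_iff_eq_star_mul_self.1 hM.nonneg
  refine ⟨fun σ => if h : σ ∈ s then WithLp.toLp 2 (fun i => B i ⟨σ, h⟩) else 0,
    fun σ hσ τ hτ => ?_⟩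
  have := congrFun (congrFun hB ⟨τ, hτ⟩) ⟨σ, hσ⟩
  simp only [Matrix.transpose_apply, Matrix.submatrix_apply, Matrix.of_apply, Matrix.mul_apply,
    Matrix.star_apply] at this
  rw [this]
  beta_reduce
  rw [dif_pos hσ, dif_pos hτ, PiLp.inner_apply]
  exact Finset.sum_congr rfl fun i _ => mul_comm _ _

theorem inner_linearCombination_linearCombination {E I : Type*} [NormedAddCommGroup E]
    [InnerProductSpace ℂ E] [Fintype I] (v w : I → E) (c c' : I → ℂ) :
    inner ℂ (Fintype.linearCombination ℂ v c) (Fintype.linearCombination ℂ w c') =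
      ∑ a, ∑ b, star (c a) * (c' b * inner ℂ (v a) (w b)) := by
  simp only [Fintype.linearCombination_apply, sum_inner, inner_smul_left]
  refine Finset.sum_congr rfl fun a _ => ?_
  rw [inner_sum, Finset.mul_sum]
  exact Finset.sum_congr rfl fun b _ => by rw [inner_smul_right]; rfl

open ContinuousLinearMap in
/-- A multi-Toeplitz kernel, restricted to words of length at most `N + 1`, comes from a row
contraction on a finite-dimensional space. -/
theorem IsMultiToeplitz.exists_rowContraction {d : ℕ} {K : Word d → Word d → ℂ}
    (hK : IsMultiToeplitz K) (N : ℕ) :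
    ∃ (v : Word d → EuclideanSpace ℂ (Word.upTo d (N + 1)))
      (X : Fin d → EuclideanSpace ℂ (Word.upTo d (N + 1)) →L[ℂ]
        EuclideanSpace ℂ (Word.upTo d (N + 1))),
      (∀ h, ∑ j, ‖adjoint (X j) h‖ ^ 2 ≤ ‖h‖ ^ 2) ∧
      (∀ σ : Word d, σ.length ≤ N + 1 → inner ℂ (v 1) (v σ) = K σ 1) ∧
      ∀ j, ∀ σ : Word d, σ.length ≤ N → X j (v σ) = v (FreeMonoid.of j * σ) := by
  classical
  obtain ⟨v, hv⟩ := hK.positive.exists_inner_eq (Word.upTo d (N + 1))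
  have hmem : ∀ σ : Word.upTo d N, σ.1 ∈ Word.upTo d (N + 1) := fun σ =>
    Word.mem_upTo.2 ((Word.mem_upTo.1 σ.2).trans N.le_succ)
  have hmem' : ∀ (j : Fin d) (σ : Word.upTo d N), FreeMonoid.of j * σ.1 ∈ Word.upTo d (N + 1) :=
    fun j σ => by
      have := Word.mem_upTo.1 σ.2
      rw [Word.mem_upTo, FreeMonoid.length_mul, FreeMonoid.length_of]
      omega
  set A := Fintype.linearCombination ℂ (fun σ : Word.upTo d N => v σ.1) with hA
  set B := fun j : Fin d =>
    Fintype.linearCombination ℂ (fun σ : Word.upTo d N => v (FreeMonoid.of j * σ.1)) with hB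
  have hBA : ∀ j c, ‖B j c‖ = ‖A c‖ := by
    intro j c
    have : inner ℂ (B j c) (B j c) = inner ℂ (A c) (A c) := by
      rw [hB, hA, inner_linearCombination_linearCombination,
        inner_linearCombination_linearCombination]
      refine Finset.sum_congr rfl fun σ _ => Finset.sum_congr rfl fun τ _ => ?_
      rw [hv _ (hmem τ) _ (hmem σ), hv _ (hmem' j τ) _ (hmem' j σ), hK.shift_invariant]
    rw [← sq_eq_sq₀ (norm_nonneg _) (norm_nonneg _), ← inner_self_eq_norm_sq (𝕜 := ℂ),
      ← inner_self_eq_norm_sq (𝕜 := ℂ), this]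
  have horth : ∀ j k, j ≠ k → ∀ c c', inner ℂ (B j c) (B k c') = 0 := by
    intro j k hjk c c'
    rw [hB, inner_linearCombination_linearCombination]
    refine Finset.sum_eq_zero fun σ _ => Finset.sum_eq_zero fun τ _ => ?_
    rw [hv _ (hmem' k τ) _ (hmem' j σ), hK.vanishing, mul_zero, mul_zero]
    rintro ⟨α, h | h⟩
    · rw [mul_assoc] at h
      exact hjk (List.cons.inj (congrArg FreeMonoid.toList h)).1.symm
    · rw [mul_assoc] at h
      exact hjk (List.cons.inj (congrArg FreeMonoid.toList h)).1
  choose X hXA hXB using fun j => exists_partialIsometry A (B j) (hBA j)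
  refine ⟨v, X, sum_norm_sq_adjoint_le X (fun j x => ?_) (fun j k hjk x y => ?_),
    fun σ hσ => hv σ (Word.mem_upTo.2 hσ) 1 (Word.mem_upTo.2 (by simp)), fun j σ hσ => ?_⟩
  · obtain ⟨c, hc, hc'⟩ := hXB j x
    rwa [hc]
  · obtain ⟨c, hc, -⟩ := hXB j x
    obtain ⟨c', hc', -⟩ := hXB k y
    rw [hc, hc', horth j k hjk]
  · have hσ' : σ ∈ Word.upTo d N := Word.mem_upTo.2 hσ
    have h := hXA j (Pi.single ⟨σ, hσ'⟩ 1)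
    rwa [hA, hB, Fintype.linearCombination_apply_single,
      Fintype.linearCombination_apply_single, one_smul, one_smul] at h

open ContinuousLinearMap in
/-- After damping by `r < 1`, the moments up to order `N + 1` of a multi-Toeplitz kernel are those
of a finite sum of vector functionals of the left free shift. -/
theorem IsMultiToeplitz.exists_sum_inner_eq {d : ℕ} {K : Word d → Word d → ℂ}
    (hK : IsMultiToeplitz K) (N : ℕ) {r : ℝ} (hr0 : 0 ≤ r) (hr1 : r < 1) :
    ∃ (m : ℕ) (f : Fin m → NCHardy d), ∀ σ : Word d, σ.length ≤ N + 1 →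
      ∑ i, inner ℂ (f i) (leftShiftPow σ (f i)) = (r : ℂ) ^ σ.length * K σ 1 := by
  obtain ⟨v, X, hX, hv, hXv⟩ := hK.exists_rowContraction N
  obtain ⟨m, f, hf⟩ := exists_sum_inner_leftShiftPow_eq (fun j => (r : ℂ) • X j)
    (q := r ^ 2) (sq_nonneg r) (by nlinarith) (fun h => by
      have : ∀ j, ‖adjoint ((r : ℂ) • X j) h‖ ^ 2 = r ^ 2 * ‖adjoint (X j) h‖ ^ 2 := fun j => by
        rw [map_smulₛₗ, smul_apply, norm_smul, mul_pow]
        simp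
      simp only [this, ← Finset.mul_sum]
      exact mul_le_mul_of_nonneg_left (hX h) (sq_nonneg r)) (v 1)
  have key : ∀ σ : Word d, σ.length ≤ N + 1 →
      FreeMonoid.lift (fun j => (r : ℂ) • X j) σ (v 1) = (r : ℂ) ^ σ.length • v σ := by
    intro σ
    induction σ using FreeMonoid.inductionOn' with
    | one => intro _; simp
    | of_mul j σ ih =>
      intro h
      rw [FreeMonoid.length_mul, FreeMonoid.length_of] at h
      rw [map_mul, FreeMonoid.lift_eval_of, mul_apply_eq_comp, ih (by omega), map_smul, smul_apply,
        hXv j σ (by omega), smul_smul, FreeMonoid.length_mul, FreeMonoid.length_of, pow_add,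
        pow_one, mul_comm]
  refine ⟨m, f, fun σ hσ => ?_⟩
  rw [hf, key σ hσ, inner_smul_right, hv σ hσ]

/-! ### The functional of a multi-Toeplitz kernel -/

/-- A bounded sequence of functionals has a pointwise limit along a nonprincipal ultrafilter. -/
theorem exists_tendsto_hyperfilter {V : Type*} [NormedAddCommGroup V] [NormedSpace ℂ V]
    (μ : ℕ → V →ₗ[ℂ] ℂ) (C : ℝ) (hμ : ∀ n T, ‖μ n T‖ ≤ C * ‖T‖) :
    ∃ φ : V →L[ℂ] ℂ, ∀ T, Filter.Tendsto (fun n => μ n T) (Filter.hyperfilter ℕ) (nhds (φ T)) := by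
  have hlim : ∀ T, ∃ z : ℂ, Filter.Tendsto (fun n => μ n T) (Filter.hyperfilter ℕ) (nhds z) := by
    intro T
    obtain ⟨z, -, hz⟩ := (isCompact_closedBall (0 : ℂ) (C * ‖T‖)).ultrafilter_le_nhds'
      ((Filter.hyperfilter ℕ).map fun n => μ n T) (by
        refine Filter.mem_map.2 (Filter.univ_mem' fun n => ?_)
        simpa using hμ n T)
    exact ⟨z, hz⟩
  choose φ hφ using hlim
  refine ⟨LinearMap.mkContinuous
    { toFun := φ
      map_add' := fun S T => tendsto_nhds_unique (hφ (S + T)) (by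
        simpa only [map_add] using (hφ S).add (hφ T))
      map_smul' := fun c T => tendsto_nhds_unique (hφ (c • T)) (by
        simpa only [map_smul, RingHom.id_apply] using (hφ T).const_smul c) } C fun T => ?_, hφ⟩
  exact le_of_tendsto (hφ T).norm (Filter.Eventually.of_forall fun n => hμ n T)

/-- The functional is a limit of positive functionals on all operators, so that its positivity on
the whole nc disc system needs no approximation of positive operators by polynomials. -/
theorem IsMultiToeplitz.exists_positive_functional {d : ℕ} {K : Word d → Word d → ℂ}
    (hK : IsMultiToeplitz K) :
    ∃ φ : NCHardyOp d →L[ℂ] ℂ, (∀ T : NCHardyOp d, T.IsPositive → 0 ≤ φ T) ∧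
      ∀ σ : Word d, φ (leftShiftPow σ) = K σ 1 ∧ φ (star (leftShiftPow σ)) = star (K σ 1) := by
  have hr : ∀ n : ℕ, (0 : ℝ) ≤ n / (n + 1) ∧ (n / (n + 1) : ℝ) < 1 := fun n =>
    ⟨by positivity, by rw [div_lt_one (by positivity)]; linarith⟩
  choose m f hf using fun n : ℕ => hK.exists_sum_inner_eq n (hr n).1 (hr n).2
  set μ : ℕ → NCHardyOp d →ₗ[ℂ] ℂ := fun n =>
    { toFun := fun T => ∑ i, inner ℂ (f n i) (T (f n i))
      map_add' := fun S T => by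
        simp only [add_apply, inner_add_right, Finset.sum_add_distrib]
      map_smul' := fun c T => by
        simp only [smul_apply, inner_smul_right, Finset.mul_sum, RingHom.id_apply, smul_eq_mul] }
    with hμdef
  have hμ : ∀ n T, μ n T = ∑ i, inner ℂ (f n i) (T (f n i)) := fun n T => rfl
  have hnorm : ∀ n, ∑ i, ‖f n i‖ ^ 2 = (K 1 1).re := by
    intro n
    have h := congrArg Complex.re (hf n 1 (by simp))
    rw [leftShiftPow_one, Complex.re_sum] at h
    simp only [FreeMonoid.length_one, pow_zero, one_mul] at h
    rw [← h]
    exact Finset.sum_congr rfl fun i _ => (inner_self_eq_norm_sq (𝕜 := ℂ) (f n i)).symm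
  obtain ⟨φ, hφ⟩ := exists_tendsto_hyperfilter μ (K 1 1).re fun n T => by
    rw [hμ, ← hnorm n, Finset.sum_mul]
    refine (norm_sum_le _ _).trans (Finset.sum_le_sum fun i _ => ?_)
    have h1 := norm_inner_le_norm (𝕜 := ℂ) (f n i) (T (f n i))
    have h2 := mul_le_mul_of_nonneg_left (T.le_opNorm (f n i)) (norm_nonneg (f n i))
    linarith
  have hmoment : ∀ σ : Word d, Filter.Tendsto (fun n => μ n (leftShiftPow σ))
      (Filter.hyperfilter ℕ) (nhds (K σ 1)) := by
    intro σ
    -- Once `n ≥ |σ|`, the truncation is exact at `σ` and only the damping `r = n / (n + 1)` remains.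
    have h1 : Filter.Tendsto (fun n : ℕ => (((n / (n + 1) : ℝ) : ℂ)) ^ σ.length * K σ 1)
        Filter.atTop (nhds (K σ 1)) := by
      have h2 := (Complex.continuous_ofReal.tendsto 1).comp
        (tendsto_natCast_div_add_atTop (1 : ℝ))
      simpa using (h2.pow σ.length).mul_const (K σ 1)
    have h3 := h1.congr' (f₂ := fun n => μ n (leftShiftPow σ)) (by
      filter_upwards [Filter.eventually_ge_atTop σ.length] with n hn
      exact (hf n σ (by omega)).symm)
    exact h3.mono_left Nat.hyperfilter_le_atTop
  refine ⟨φ, fun T hT => ge_of_tendsto (hφ T) (Filter.Eventually.of_forall fun n =>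
    Finset.sum_nonneg fun i _ => hT.inner_nonneg_right (f n i)), fun σ =>
    ⟨tendsto_nhds_unique (hφ _) (hmoment σ), tendsto_nhds_unique (hφ _) ?_⟩⟩
  refine ((hmoment σ).star).congr fun n => ?_
  rw [hμ, hμ, star_sum]
  refine Finset.sum_congr rfl fun i _ => ?_
  rw [ContinuousLinearMap.star_eq_adjoint, ContinuousLinearMap.adjoint_inner_right]
  exact inner_conj_symm _ _

theorem IsMultiToeplitz.apply_one_left {d : ℕ} {K : Word d → Word d → ℂ} (hK : IsMultiToeplitz K)
    (σ : Word d) : K 1 σ = star (K σ 1) := by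
  classical
  obtain ⟨σ₀, hσ₀⟩ := Word.exists_forall_shortlexLE ({σ, 1} : Finset (Word d))
  exact ((hK.positive σ₀).1.apply ⟨1, hσ₀ 1 (by simp)⟩ ⟨σ, hσ₀ σ (by simp)⟩).symm

/-- A multi-Toeplitz kernel is determined by its values at the pairs `(σ, 1)` and `(1, σ)`. -/
theorem HasMoments.kernelOf_eq {d : ℕ} {K : Word d → Word d → ℂ} (hK : IsMultiToeplitz K)
    {μ : ncDiscSystem d →ₗ[ℂ] ℂ} (hμ : HasMoments μ K) : kernelOf μ = K := by
  have h1 : ∀ σ, kernelOf μ σ 1 = K σ 1 := fun σ =>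
    (hasMoments_kernelOf μ σ).1.symm.trans (hμ σ).1
  have h2 : ∀ σ, kernelOf μ 1 σ = K 1 σ := fun σ =>
    (hasMoments_kernelOf μ σ).2.symm.trans (hμ σ).2
  funext σ τ
  by_cases h : ∃ α : Word d, σ = τ * α ∨ τ = σ * α
  · obtain ⟨α, rfl | rfl⟩ := h
    · have e1 := kernelOf_mul_mul μ τ α 1
      have e2 := hK.shift_invariant τ α 1
      rw [mul_one] at e1 e2
      rw [e1, e2, h1]
    · have e1 := kernelOf_mul_mul μ σ 1 α
      have e2 := hK.shift_invariant σ 1 α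
      rw [mul_one] at e1 e2
      rw [e1, e2, h2]
  · rw [kernelOf_eq_zero μ σ τ h, hK.vanishing σ τ h]

theorem IsMultiToeplitz.exists_isNCMeasure {d : ℕ} {K : Word d → Word d → ℂ}
    (hK : IsMultiToeplitz K) :
    ∃ μ : ncDiscSystem d →L[ℂ] ℂ, IsNCMeasure (μ : ncDiscSystem d →ₗ[ℂ] ℂ) ∧
      HasMoments (μ : ncDiscSystem d →ₗ[ℂ] ℂ) K := by
  obtain ⟨φ, hpos, hφ⟩ := hK.exists_positive_functional
  exact ⟨φ.comp (ncDiscSystem d).subtypeL, fun T hT => hpos T hT, fun σ =>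
    ⟨(hφ σ).1, (hφ σ).2.trans (hK.apply_one_left σ).symm⟩⟩

theorem mainTheorem2 (d : ℕ) :
    (∀ K : Word d → Word d → ℂ, IsMultiToeplitz K →
      (∀ σ : Word d, K 1 σ = star (K σ 1)) ∧
      ∃ μ : ncDiscSystem d →L[ℂ] ℂ,
        HasMoments (μ : ncDiscSystem d →ₗ[ℂ] ℂ) K ∧
        (∀ ν : ncDiscSystem d →L[ℂ] ℂ,
          HasMoments (ν : ncDiscSystem d →ₗ[ℂ] ℂ) K → ν = μ) ∧
        IsNCMeasure (μ : ncDiscSystem d →ₗ[ℂ] ℂ) ∧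
        (∀ ν : ncDiscSystem d →ₗ[ℂ] ℂ, IsNCMeasure ν → HasMoments ν K →
          ν = (μ : ncDiscSystem d →ₗ[ℂ] ℂ)) ∧
        kernelOf (μ : ncDiscSystem d →ₗ[ℂ] ℂ) = K) ∧
    (∀ μ : ncDiscSystem d →ₗ[ℂ] ℂ, IsNCMeasure μ → IsMultiToeplitz (kernelOf μ)) ∧
    Set.BijOn kernelOf {μ : ncDiscSystem d →ₗ[ℂ] ℂ | IsNCMeasure μ}
      {K : Word d → Word d → ℂ | IsMultiToeplitz K} := by
  refine ⟨fun K hK => ⟨hK.apply_one_left, ?_⟩, fun μ hμ => hμ.isMultiToeplitz_kernelOf,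
    fun μ hμ => hμ.isMultiToeplitz_kernelOf, ?_, ?_⟩
  · obtain ⟨μ, hμ, hμK⟩ := hK.exists_isNCMeasure
    refine ⟨μ, hμK, fun ν hν => hν.unique hμK, hμ, fun ν hν hνK => ?_, hμK.kernelOf_eq hK⟩
    obtain ⟨ν, rfl⟩ := hν.exists_continuousLinearMap_eq
    rw [hνK.unique hμK]
  · intro μ hμ ν hν h
    obtain ⟨μ, rfl⟩ := IsNCMeasure.exists_continuousLinearMap_eq hμ
    obtain ⟨ν, rfl⟩ := IsNCMeasure.exists_continuousLinearMap_eq hν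
    rw [(hasMoments_kernelOf (μ : ncDiscSystem d →ₗ[ℂ] ℂ)).unique
      (h ▸ hasMoments_kernelOf (ν : ncDiscSystem d →ₗ[ℂ] ℂ))]
  · intro K hK
    obtain ⟨μ, hμ, hμK⟩ := IsMultiToeplitz.exists_isNCMeasure hK
    exact ⟨μ, hμ, hμK.kernelOf_eq hK⟩
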